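/- Let $X$ be a (real, finite-dimensional, Hausdorff) smooth manifold and $V\to X$ a smooth real vector bundle of finite positive rank. Put $Z=C^\infty(X)$ and $A=C^\infty(X,V)$, a $Z$-module. \textbf{Definitions.} Suppose that $A$ carries a structure of associative unital $Z$-algebra, so that $f\mapsto f\cdot 1$ maps $Z$ into the centre of $A$. A \emph{Poisson fibred algebra structure} on the pair $(A,Z)$ consists of a Poisson bracket on $Z$ and an $\mathbb R$-bilinear map $Z\times A\to A$, $(f,a)\mapsto\{f,a\}$, such that $f\mapsto f\cdot 1$ is injective, $\{f,g\cdot 1\}=\{f,g\}\cdot 1$, $\{f,ab\}=\{f,a\}b+a\{f,b\}$ and $\{fg,a\}=f\{g,a\}+g\{f,a\}$ for $f,g\in Z$, $a,b\in A$. Its curvature is $\Phi(f,g)(a)=\{\{f,g\},a\}-\{f,\{g,a\}\}+\{g,\{f,a\}\}$. It is \emph{local} if $\{f,a\}$ vanishes on every open set on which $f$ or $a$ vanishes. A Poisson bracket on $C^\infty(X)$ with bivector $P$ makes $T^*X$ a Lie algebroid, with anchor $\rho:T^*X\to TX$, $dg(\rho(df))=\{f,g\}$, and bracket $[\omega,\varphi]=L_{\rho(\omega)}\varphi-L_{\rho(\varphi)}\omega-d(P(\omega,\varphi))$,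 where $P(\omega,\varphi)=\varphi(\rho(\omega))$; this bracket extends $[df,dg]=d\{f,g\}$ by the Leibniz rule. A \emph{$T^*X$-connection} on $V$ is a smooth anchor-preserving vector bundle map $\nabla$ from $T^*X$ to the Atiyah algebroid of $V$, that is, $\nabla_\omega(fa)=f\nabla_\omega a+(\rho(\omega)f)\,a$. Its curvature is $\Phi_\nabla(\omega,\varphi)=\nabla_{[\omega,\varphi]}-[\nabla_\omega,\nabla_\varphi]$. \textbf{Theorem.} (1) Let $X$ be a Poisson manifold, let $V$ be a bundle of associative unital algebras (the fibrewise product and the unit are smooth), and let $\nabla$ be a $T^*X$-connection on $V$ with $\nabla_\omega(ab)=(\nabla_\omega a)b+a(\nabla_\omega b)$ for all 1-forms $\omega$ and sections $a,b$. Then $\{f,a\}=\nabla_{df}a$, together with the given Poisson bracket on $Z$, is a Poisson fibred algebra structure on $(A,Z)$, and $\Phi(f,g)=\Phi_\nabla(df,dg)$ for all $f,g\in Z$. If the centre of every fibre consists of the scalar multiples of the unit, then $Z\cdot 1$ is the whole centre of $A$. (2) Conversely, let $A$ carry any structure of associative unital $Z$-algebra, and let $\{\cdot,\cdot\}$ be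 a local Poisson fibred algebra structure on $(A,Z)$. Then, for the Poisson structure on $X$ given by the bracket on $Z$, there is a unique $T^*X$-connection $\nabla$ on $V$ with $\{f,a\}=\nabla_{df}a$ for all $f\in Z$, $a\in A$. It satisfies $\nabla_\omega(ab)=(\nabla_\omega a)b+a(\nabla_\omega b)$, and $\Phi(f,g)=\Phi_\nabla(df,dg)$ for all $f,g\in Z$. -/

import Mathlib

open scoped Manifold ContDiff Topology

noncomputable section

/-! ### Algebra -/

/-- A Poisson bracket on a commutative algebra `Z` over a field `κ`: a Lie bracket, bilinear over
`κ`, acting by derivations of the multiplication. -/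
structure PoissonBracket (κ Z : Type*) [Field κ] [CommRing Z] [Algebra κ Z] where
  bracket : Z →ₗ[κ] Z →ₗ[κ] Z
  bracket_self : ∀ f, bracket f f = 0
  jacobi : ∀ f g h,
    bracket f (bracket g h) + bracket g (bracket h f) + bracket h (bracket f g) = 0
  leibniz : ∀ f g h, bracket f (g * h) = bracket f g * h + g * bracket f h

/-- A structure of associative unital algebra over the commutative ring `Z` on the `Z`-module `A`:
the product is `Z`-bilinear, so that `f ↦ f • one` maps `Z` into the centre of `A`. -/
structure AlgebraStructure (Z A : Type*) [CommRing Z] [AddCommGroup A] [Module Z A] where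
  mul : A →ₗ[Z] A →ₗ[Z] A
  one : A
  mul_assoc : ∀ a b c, mul (mul a b) c = mul a (mul b c)
  one_mul : ∀ a, mul one a = a
  mul_one : ∀ a, mul a one = a

/-- `c` lies in the centre of the algebra. -/
def AlgebraStructure.IsCentral {Z A : Type*} [CommRing Z] [AddCommGroup A] [Module Z A]
    (m : AlgebraStructure Z A) (c : A) : Prop :=
  ∀ a, m.mul c a = m.mul a c

/-- The `κ`-bilinear map `br : Z × A → A` is a Poisson fibred algebra structure on the pair
`(A, Z)`, where `A` carries the associative algebra structure `m`, the Poisson algebra `Z` carries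
the bracket `P`, and `Z` is identified with the central subalgebra of all `f • 1`. -/
structure IsPoissonFibredAlgebra {κ Z A : Type*} [Field κ] [CommRing Z] [Algebra κ Z]
    [AddCommGroup A] [Module κ A] [Module Z A]
    (P : PoissonBracket κ Z) (m : AlgebraStructure Z A) (br : Z →ₗ[κ] A →ₗ[κ] A) : Prop where
  injective : Function.Injective (fun f : Z => f • m.one)
  restrict : ∀ f g : Z, br f (g • m.one) = P.bracket f g • m.one
  map_mul : ∀ f a b, br f (m.mul a b) = m.mul (br f a) b + m.mul a (br f b)
  mul_map : ∀ f g a, br (f * g) a = f • br g a + g • br f a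

/-- The curvature `Φ(f, g)(a) = {{f, g}, a} - {f, {g, a}} + {g, {f, a}}` of a Poisson fibred
algebra. -/
def poissonFibredCurvature {κ Z A : Type*} [Field κ] [CommRing Z] [Algebra κ Z]
    [AddCommGroup A] [Module κ A]
    (P : PoissonBracket κ Z) (br : Z →ₗ[κ] A →ₗ[κ] A) (f g : Z) (a : A) : A :=
  br (P.bracket f g) a - br f (br g a) + br g (br f a)

open MeasureTheory in
/-- Hadamard's lemma. -/
theorem exists_smooth_hadamard {E : Type*} [NormedAddCommGroup E] [NormedSpace ℝ E]
    {G : E → ℝ} (hG : ContDiff ℝ ∞ G) (x₀ : E) :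
    ∃ h : E → E →L[ℝ] ℝ, ContDiff ℝ ∞ h ∧ (∀ y, G y = G x₀ + h y (y - x₀)) ∧
      h x₀ = fderiv ℝ G x₀ := by
  have hG' : ContDiff ℝ ∞ (fderiv ℝ G) := hG.fderiv_right (by simp)
  refine ⟨fun y => ∫ t in (0:ℝ)..1, fderiv ℝ G (x₀ + t • (y - x₀)), ?_, ?_, ?_⟩
  · let ψ : ContDiffBump (0 : ℝ) := ⟨2, 3, by norm_num, by norm_num⟩
    have key := contDiffOn_convolution_right_with_param_comp (𝕜 := ℝ) (n := ⊤) (μ := volume)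
      (ContinuousLinearMap.lsmul ℝ ℝ : ℝ →L[ℝ] (E →L[ℝ] ℝ) →L[ℝ] (E →L[ℝ] ℝ))
      (s := (Set.univ : Set E)) (v := fun _ => (0:ℝ)) contDiffOn_const
      (f := Set.indicator (Set.Ioc (0:ℝ) 1) 1)
      (g := fun y t => ψ t • fderiv ℝ G (x₀ + (-t) • (y - x₀))) (k := tsupport ψ)
      isOpen_univ ψ.hasCompactSupport
      (fun y t _ ht => by simp [image_eq_zero_of_notMem_tsupport ht])
      ((integrable_indicator_iff measurableSet_Ioc).2 (by
        simp [integrableOn_const_iff, Pi.one_def])).locallyIntegrable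
      (by
        apply ContDiff.contDiffOn
        apply ContDiff.smul
        · exact ψ.contDiff.comp contDiff_snd
        · exact hG'.comp (by fun_prop))
    rw [contDiffOn_univ] at key
    convert key using 1
    funext y
    rw [intervalIntegral.integral_of_le zero_le_one, convolution_def,
      ← integral_indicator measurableSet_Ioc]
    congr 1
    ext1 t
    by_cases ht : t ∈ Set.Ioc (0:ℝ) 1
    · have : ψ (-t) = 1 := ψ.one_of_mem_closedBall (by
        simp only [Metric.mem_closedBall, dist_zero_right, norm_neg, Real.norm_eq_abs]
        rw [abs_of_pos ht.1]; change t ≤ 2; linarith [ht.2])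
      simp [ht, this]
    · simp [ht]
  · intro y
    have h1 : ∀ t ∈ Set.uIcc (0:ℝ) 1, HasDerivAt (fun t : ℝ => G (x₀ + t • (y - x₀)))
        (fderiv ℝ G (x₀ + t • (y - x₀)) (y - x₀)) t := by
      intro t _
      have a := (hG.differentiable (by simp) (x₀ + t • (y - x₀))).hasFDerivAt
      refine a.comp_hasDerivAt t ?_
      simpa using ((hasDerivAt_id t).smul_const (y - x₀)).const_add x₀
    have hc : Continuous fun t : ℝ => fderiv ℝ G (x₀ + t • (y - x₀)) :=
      hG'.continuous.comp (by fun_prop)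
    have h2 := intervalIntegral.integral_eq_sub_of_hasDerivAt h1
      ((hc.clm_apply continuous_const).intervalIntegrable _ _)
    rw [← ContinuousLinearMap.intervalIntegral_apply (hc.intervalIntegrable _ _)] at h2
    simp at h2
    simp [h2]
  · simp

/-! ### Smooth functions, 1-forms and sections of vector bundles -/

variable (E : Type*) [NormedAddCommGroup E] [NormedSpace ℝ E]
  (M : Type*) [TopologicalSpace M] [ChartedSpace E M]

/-- The algebra `C^∞(M)`. -/
abbrev SmoothFn := C^∞⟮𝓘(ℝ, E), M; 𝓘(ℝ, ℝ), ℝ⟯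

variable {M} in
/-- The cotangent space at `x`. -/
abbrev CotangentSpace (x : M) := TangentSpace 𝓘(ℝ, E) x →L[ℝ] ℝ


variable [IsManifold 𝓘(ℝ, E) ∞ M] in
/-- Smooth 1-forms, that is, smooth sections of the cotangent bundle. -/
abbrev OneForm :=
  Cₛ^∞⟮𝓘(ℝ, E); E →L[ℝ] ℝ, fun x : M => TangentSpace 𝓘(ℝ, E) x →L[ℝ] Bundle.Trivial M ℝ x⟯

variable {E M}

variable (E) in
/-- The differential of a function at a point. -/
def diffAt (f : M → ℝ) (x : M) : CotangentSpace E x := mvfderiv 𝓘(ℝ, E) f x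

theorem diffAt_add (f g : SmoothFn E M) (x : M) :
    diffAt E (f + g : SmoothFn E M) x = diffAt E f x + diffAt E g x :=
  mvfderiv_add f.mdifferentiableAt g.mdifferentiableAt

theorem diffAt_smul (c : ℝ) (f : SmoothFn E M) (x : M) :
    diffAt E (c • f : SmoothFn E M) x = c • diffAt E f x := by
  have h := mvfderiv_smul (I := 𝓘(ℝ, E)) (a := fun _ : M => c) (g := f) (x := x)
    mdifferentiableAt_const f.mdifferentiableAt
  rw [mvfderiv_const] at h
  refine Eq.trans h ?_
  ext v
  simp [diffAt]

theorem diffAt_sub (f g : SmoothFn E M) (x : M) :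
    diffAt E (f - g : SmoothFn E M) x = diffAt E f x - diffAt E g x :=
  mvfderiv_sub f.mdifferentiableAt g.mdifferentiableAt

variable [IsManifold 𝓘(ℝ, E) ∞ M]

/-- The differential of a smooth function. -/
def differential (f : SmoothFn E M) : OneForm E M where
  toFun x := diffAt E f x
  contMDiff_toFun := by
    intro x₀
    rw [contMDiffAt_hom_bundle]
    refine ⟨contMDiffAt_id, ?_⟩
    have := (f.contMDiff x₀).mfderiv_const (m := ∞) (n := ∞) (by simp)
    refine this.congr_of_eventuallyEq ?_
    filter_upwards with x
    unfold inTangentCoordinates ContinuousLinearMap.inCoordinates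
    ext v
    simp [diffAt, mvfderiv, NormedSpace.fromTangentSpace]
    rfl


/-! ### The cotangent Lie algebroid of a Poisson manifold -/

section Cotangent
variable [FiniteDimensional ℝ E] [T2Space M]

/-- A point derivation of `C^∞(M)` depends only on the differential at that point. -/
theorem pointDerivation_eq_zero {x : M} (D : SmoothFn E M →ₗ[ℝ] ℝ)
    (hD : ∀ f g, D (f * g) = f x * D g + g x * D f) (g : SmoothFn E M)
    (hg : g x = 0) (hdg : diffAt E g x = 0) : D g = 0 := by
  let χ : SmoothBumpFunction 𝓘(ℝ, E) x := Classical.arbitrary _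
  let φ := extChartAt 𝓘(ℝ, E) x
  have hχd : ∀ z ∈ φ.source, χ z = χ.toContDiffBump (φ z) := fun z hz =>
    χ.eqOn_source (by simpa [φ] using hz)
  have hφx : x ∈ φ.source := mem_extChartAt_source x
  have htar : IsOpen φ.target := isOpen_extChartAt_target x
  have hgs : ∀ y ∈ φ.target, ContDiffAt ℝ ∞ (fun y => g (φ.symm y)) y := by
    intro y hy
    rw [← contMDiffAt_iff_contDiffAt]
    exact g.contMDiff.contMDiffAt.comp y
      ((contMDiffOn_extChartAt_symm (n := ∞) x).contMDiffAt (htar.mem_nhds hy))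
  let G : E → ℝ := fun y => χ.toContDiffBump y * g (φ.symm y)
  have hG : ContDiff ℝ ∞ G := by
    rw [contDiff_iff_contDiffAt]
    intro y
    by_cases hy : y ∈ Metric.closedBall (φ x) χ.rOut
    · exact χ.toContDiffBump.contDiffAt.mul (hgs y (χ.closedBall_subset ⟨hy, by simp⟩))
    · refine (contDiffAt_const (c := (0:ℝ))).congr_of_eventuallyEq ?_
      filter_upwards [Metric.isClosed_closedBall.isOpen_compl.mem_nhds hy] with z hz
      have : χ.toContDiffBump z = 0 := χ.toContDiffBump.zero_of_le_dist (by
        have hz' : ¬ dist z (φ x) ≤ χ.rOut := hz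
        exact (not_le.1 hz').le)
      exact mul_eq_zero_of_left this _
  obtain ⟨h, hh, hGh, hh0⟩ := exists_smooth_hadamard hG (φ x)
  have hG0 : G (φ x) = 0 := by simp [G, φ.left_inv hφx, hg]
  have hh0' : h (φ x) = 0 := by
    rw [hh0]
    have e1 : G =ᶠ[𝓝 (φ x)] fun y => g (φ.symm y) := by
      filter_upwards [χ.toContDiffBump.eventuallyEq_one] with y hy
      change χ.toContDiffBump y * _ = _
      rw [hy, Pi.one_apply, one_mul]
    rw [e1.fderiv_eq, ← mfderiv_eq_fderiv]
    have e2 : MDifferentiableAt 𝓘(ℝ, E) 𝓘(ℝ, E) φ.symm (φ x) :=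
      ((contMDiffOn_extChartAt_symm (n := ∞) x).contMDiffAt
        (htar.mem_nhds (φ.map_source hφx))).mdifferentiableAt (by simp)
    have e3 : MDifferentiableAt 𝓘(ℝ, E) 𝓘(ℝ, ℝ) g (φ.symm (φ x)) :=
      g.mdifferentiableAt
    have e4 : mfderiv 𝓘(ℝ, E) 𝓘(ℝ, ℝ) g (φ.symm (φ x)) = 0 := by
      rw [φ.left_inv hφx]; exact hdg
    have e5 := mfderiv_comp (φ x) e3 e2
    rw [e4] at e5
    refine e5.trans ?_
    ext v; rfl
  let b := Module.finBasis ℝ E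
  have hφs : ContMDiffOn 𝓘(ℝ, E) 𝓘(ℝ, E) ∞ φ (chartAt E x).source := contMDiffOn_extChartAt
  let X : SmoothFn E M := ⟨χ, χ.contMDiff⟩
  let p : Fin (Module.finrank ℝ E) → SmoothFn E M := fun i =>
    ⟨fun z => χ z • (b.coord i).toContinuousLinearMap (φ z - φ x), χ.contMDiff_smul (by
      exact ((b.coord i).toContinuousLinearMap.contDiff.comp
        (contDiff_id.sub contDiff_const)).contMDiff.comp_contMDiffOn hφs)⟩
  let q : Fin (Module.finrank ℝ E) → SmoothFn E M := fun i =>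
    ⟨fun z => χ z • h (φ z) (b i), χ.contMDiff_smul (by
      exact (hh.clm_apply contDiff_const).contMDiff.comp_contMDiffOn hφs)⟩
  have key : X * X * X * g = ∑ i, p i * q i := by
    ext z
    have hs : (∑ i, p i * q i) z = ∑ i, p i z * q i z := by
      have := map_sum (ContMDiffMap.coeFnRingHom (I := 𝓘(ℝ, E)) (N := M) (n := ∞)
        (I' := 𝓘(ℝ, ℝ)) (R := ℝ)) (fun i => p i * q i) Finset.univ
      have := congrFun this z
      rw [Finset.sum_apply] at this
      exact this
    rw [hs]
    change χ z * χ z * χ z * g z = ∑ i, (χ z * b.coord i (φ z - φ x)) * (χ z * h (φ z) (b i))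
    by_cases hz : z ∈ φ.source
    · have h1 : χ z * g z = h (φ z) (φ z - φ x) := by
        have := hGh (φ z)
        rw [hG0, zero_add] at this
        rw [← this, hχd z hz]
        simp [G, φ.left_inv hz]
      have h2 : h (φ z) (φ z - φ x) = ∑ i, b.coord i (φ z - φ x) * h (φ z) (b i) := by
        conv_lhs => rw [← b.sum_repr (φ z - φ x)]
        simp
      rw [mul_assoc, h1, h2, Finset.mul_sum]
      exact Finset.sum_congr rfl fun i _ => by ring
    · have : χ z = 0 := by
        rw [χ.coe_def]; exact Set.indicator_of_notMem (by simpa [φ] using hz) _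
      simp [this]
  have hX : X x = 1 := χ.eq_one
  have hp : ∀ i, p i x = 0 := fun i => by
    change χ x * b.coord i (φ x - φ x) = 0
    simp
  have hq : ∀ i, q i x = 0 := fun i => by
    change χ x * h (φ x) (b i) = 0
    simp [hh0']
  have h3 := congrArg D key
  rw [map_sum, hD] at h3
  simpa [hD, hp, hq, hg, hX] using h3

/-- Every covector is the differential of a smooth function, depending linearly on it. -/
theorem exists_diffAt_section (x : M) :
    ∃ s : CotangentSpace E x →ₗ[ℝ] SmoothFn E M, ∀ α, diffAt E (s α) x = α := by
  let χ : SmoothBumpFunction 𝓘(ℝ, E) x := Classical.arbitrary _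
  let φ := extChartAt 𝓘(ℝ, E) x
  have hφs : ContMDiffOn 𝓘(ℝ, E) 𝓘(ℝ, E) ∞ φ (chartAt E x).source := contMDiffOn_extChartAt
  let S : E →L[ℝ] TangentSpace 𝓘(ℝ, E) x := (mfderiv 𝓘(ℝ, E) 𝓘(ℝ, E) φ x).inverse
  let s₀ : CotangentSpace E x → SmoothFn E M := fun α =>
    ⟨fun z => χ z • α (S (φ z - φ x)), χ.contMDiff_smul (by
      exact (((show TangentSpace 𝓘(ℝ, E) x →L[ℝ] ℝ from α).comp S).contDiff.comp
        (contDiff_id.sub contDiff_const)).contMDiff.comp_contMDiffOn hφs)⟩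
  refine ⟨⟨⟨s₀, fun α β => ?_⟩, fun c α => ?_⟩, fun α => ?_⟩
  · ext z
    exact mul_add (χ z) _ _
  · ext z
    exact mul_left_comm (χ z) c _
  · have h1 : (s₀ α : M → ℝ) =ᶠ[𝓝 x]
        (((show TangentSpace 𝓘(ℝ, E) x →L[ℝ] ℝ from α).comp S) ∘ fun z => φ z - φ x) := by
      filter_upwards [χ.eventuallyEq_one] with z hz
      change χ z * _ = _
      rw [hz, Pi.one_apply, one_mul]
      rfl
    let A : E →L[ℝ] ℝ := (show TangentSpace 𝓘(ℝ, E) x →L[ℝ] ℝ from α).comp S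
    have h2 : HasMFDerivAt 𝓘(ℝ, E) 𝓘(ℝ, E) φ x (mfderiv 𝓘(ℝ, E) 𝓘(ℝ, E) φ x) :=
      (mdifferentiableAt_extChartAt (mem_chart_source E x)).hasMFDerivAt
    have h3 : HasFDerivAt (fun y : E => A (y - φ x)) A (φ x) :=
      A.hasFDerivAt.comp (φ x) ((hasFDerivAt_id (φ x)).sub_const (φ x))
    have h4 := (h3.hasMFDerivAt.comp x h2).congr_of_eventuallyEq h1
    have h5 : diffAt E (s₀ α) x = A.comp (mfderiv 𝓘(ℝ, E) 𝓘(ℝ, E) φ x) := by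
      have := h4.mfderiv
      unfold diffAt mvfderiv
      rw [this]
      rfl
    refine h5.trans ?_
    ext v
    change α (S (mfderiv 𝓘(ℝ, E) 𝓘(ℝ, E) φ x v)) = α v
    congr 1
    have hi := isInvertible_mfderiv_extChartAt (I := 𝓘(ℝ, E))
      (mem_extChartAt_source (I := 𝓘(ℝ, E)) x)
    exact hi.inverse_apply_eq.2 rfl

/-- A Poisson bracket on `C^∞(M)` is given by a bivector field: the value at `x` of `{f, g}` is
obtained from `df_x` and `dg_x`. -/
theorem PoissonBracket.existsUnique_anchor (P : PoissonBracket ℝ (SmoothFn E M)) (x : M) :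
    ∃! ρ : CotangentSpace E x →ₗ[ℝ] TangentSpace 𝓘(ℝ, E) x,
      ∀ f g : SmoothFn E M, diffAt E g x (ρ (diffAt E f x)) = P.bracket f g x := by
  obtain ⟨s, hs⟩ := exists_diffAt_section (E := E) x
  have skew : ∀ f g, P.bracket f g = - P.bracket g f := fun f g => by
    have := P.bracket_self (f + g)
    simp only [map_add, LinearMap.add_apply, P.bracket_self, zero_add, add_zero] at this
    exact eq_neg_of_add_eq_zero_right this
  have kill : ∀ f g : SmoothFn E M, diffAt E g x = 0 → P.bracket f g x = 0 := by
    intro f g hg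
    let ev : SmoothFn E M →ₗ[ℝ] ℝ :=
      { toFun := fun h => h x, map_add' := fun _ _ => rfl, map_smul' := fun _ _ => rfl }
    let D : SmoothFn E M →ₗ[ℝ] ℝ := ev.comp (P.bracket f)
    have hD : ∀ a b, D (a * b) = a x * D b + b x * D a := fun a b => by
      change P.bracket f (a * b) x = a x * P.bracket f b x + b x * P.bracket f a x
      rw [P.leibniz]
      change P.bracket f a x * b x + a x * P.bracket f b x = _
      ring
    have h1 : D 1 = 0 := by
      have := hD 1 1
      rw [mul_one] at this
      change D 1 = 1 * D 1 + 1 * D 1 at this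
      linarith
    have h2 : D (g - g x • 1) = 0 := by
      refine pointDerivation_eq_zero (x := x) D hD _ ?_ ?_
      · change g x - g x * 1 = 0
        ring
      · have h1 : diffAt E (1 : SmoothFn E M) x = 0 := mvfderiv_const (1 : ℝ)
        rw [diffAt_sub, diffAt_smul, hg, h1, smul_zero, sub_zero]
    have h3 : D g = 0 := by
      rw [map_sub, map_smul, h1, smul_zero, sub_zero] at h2
      exact h2
    exact h3
  have swap : ∀ f g f' g' : SmoothFn E M, diffAt E f x = diffAt E f' x →
      diffAt E g x = diffAt E g' x → P.bracket f g x = P.bracket f' g' x := by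
    intro f g f' g' hf hg
    have h1 : P.bracket f (g - g') x = 0 := kill f _ (by rw [diffAt_sub, hg, sub_self])
    have h2 : P.bracket g' (f - f') x = 0 := kill g' _ (by rw [diffAt_sub, hf, sub_self])
    rw [map_sub] at h1 h2
    change P.bracket f g x - P.bracket f g' x = 0 at h1
    change P.bracket g' f x - P.bracket g' f' x = 0 at h2
    have h3 : P.bracket f g' x = - P.bracket g' f x := by rw [skew]; rfl
    have h4 : P.bracket f' g' x = - P.bracket g' f' x := by rw [skew]; rfl
    linarith
  let T := TangentSpace 𝓘(ℝ, E) x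
  let e : Module.Dual ℝ T ≃ₗ[ℝ] CotangentSpace E x :=
    LinearMap.toContinuousLinearMap (𝕜 := ℝ) (E := E) (F' := ℝ)
  have he : ∀ (ℓ : Module.Dual ℝ T) (v : T), e ℓ v = ℓ v := fun _ _ => rfl
  let B : CotangentSpace E x →ₗ[ℝ] Module.Dual ℝ (Module.Dual ℝ T) :=
    LinearMap.mk₂ ℝ (fun α ℓ => P.bracket (s α) (s (e ℓ)) x)
      (fun α β ℓ => by rw [map_add, map_add]; rfl)
      (fun c α ℓ => by rw [map_smul, map_smul]; rfl)
      (fun α ℓ k => by rw [map_add, map_add, map_add]; rfl)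
      (fun c α ℓ => by rw [map_smul, map_smul, map_smul]; rfl)
  have : FiniteDimensional ℝ T := inferInstanceAs (FiniteDimensional ℝ E)
  let ρ : CotangentSpace E x →ₗ[ℝ] T := (Module.evalEquiv ℝ T).symm.toLinearMap.comp B
  have hρ : ∀ α β : CotangentSpace E x, β (ρ α) = P.bracket (s α) (s β) x := by
    intro α β
    have h1 : Module.evalEquiv ℝ T (ρ α) = B α := (Module.evalEquiv ℝ T).apply_symm_apply _
    have h2 := LinearMap.congr_fun h1 (e.symm β)
    have h3 : B α (e.symm β) = P.bracket (s α) (s β) x := by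
      change P.bracket (s α) (s (e (e.symm β))) x = _
      rw [e.apply_symm_apply]
    rw [h3] at h2
    exact h2
  refine ⟨ρ, fun f g => ?_, fun ρ' h' => ?_⟩
  · rw [hρ]
    exact swap _ _ _ _ (hs _) (hs _)
  · refine LinearMap.ext fun α => ?_
    refine (Module.evalEquiv ℝ T).injective (LinearMap.ext fun ℓ => ?_)
    change ℓ (ρ' α) = ℓ (ρ α)
    have h1 := h' (s α) (s (e ℓ))
    rw [hs, hs] at h1
    have h2 := hρ α (e ℓ)
    exact h1.trans h2.symm

/-- The anchor `ρ : T*M → TM` of the cotangent Lie algebroid: contraction with the Poisson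
bivector, so that `dg (ρ (df)) = {f, g}`. -/
def PoissonBracket.anchor (P : PoissonBracket ℝ (SmoothFn E M)) (x : M) :
    CotangentSpace E x →ₗ[ℝ] TangentSpace 𝓘(ℝ, E) x :=
  (P.existsUnique_anchor x).choose

theorem PoissonBracket.anchor_spec (P : PoissonBracket ℝ (SmoothFn E M)) (x : M)
    (f g : SmoothFn E M) : diffAt E g x (P.anchor x (diffAt E f x)) = P.bracket f g x :=
  (P.existsUnique_anchor x).choose_spec.1 f g

/-- The 1-form `φ` in the chart at `x`: its pullback under the inverse of the chart. -/
def oneFormInChart (φ : ∀ y : M, CotangentSpace E y) (x : M) (y : E) : E →L[ℝ] ℝ :=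
  (φ ((extChartAt 𝓘(ℝ, E) x).symm y)).comp
    (mfderiv 𝓘(ℝ, E) 𝓘(ℝ, E) (extChartAt 𝓘(ℝ, E) x).symm y)

/-- The contraction `ι_u dφ` of the exterior derivative of the 1-form `φ` with the tangent vector
`u` at `x`, computed in the chart at `x`: there `(dφ)(u, v) = (D_u φ)(v) - (D_v φ)(u)`. -/
def contractExtDeriv (φ : ∀ y : M, CotangentSpace E y) (x : M) (u : TangentSpace 𝓘(ℝ, E) x) :
    CotangentSpace E x :=
  let T : TangentSpace 𝓘(ℝ, E) x →L[ℝ] E :=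
    mfderiv 𝓘(ℝ, E) 𝓘(ℝ, E) (extChartAt 𝓘(ℝ, E) x) x
  let D : E →L[ℝ] E →L[ℝ] ℝ := fderiv ℝ (oneFormInChart φ x) (extChartAt 𝓘(ℝ, E) x x)
  (D (T u) - D.flip (T u)).comp T

/-- The Lie derivative `L_ξ φ = ι_ξ dφ + d (φ(ξ))` of a 1-form along a vector field. -/
def lieDerivOneForm (ξ : ∀ y : M, TangentSpace 𝓘(ℝ, E) y) (φ : ∀ y : M, CotangentSpace E y)
    (x : M) : CotangentSpace E x :=
  contractExtDeriv φ x (ξ x) + diffAt E (fun y => φ y (ξ y)) x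

/-- The bracket `[η, φ] = L_{ρ(η)} φ - L_{ρ(φ)} η - d (P(η, φ))` of 1-forms on a Poisson manifold,
where `P(η, φ) = φ(ρ(η))`, so that `P(df, dg) = {f, g}`. It is the extension of
`[df, dg] = d{f, g}` by the Leibniz rule of a Lie algebroid. -/
def PoissonBracket.formBracket (P : PoissonBracket ℝ (SmoothFn E M)) (η φ : OneForm E M) (x : M) :
    CotangentSpace E x :=
  lieDerivOneForm (fun y => P.anchor y (η y)) φ x
    - lieDerivOneForm (fun y => P.anchor y (φ y)) η x
    - diffAt E (fun y => φ y (P.anchor y (η y))) x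

end Cotangent

/-! ### Sections of vector bundles, bundles of algebras, connections -/

section Bundle
variable {F : Type*} [NormedAddCommGroup F] [NormedSpace ℝ F]
  {V : M → Type*} [TopologicalSpace (Bundle.TotalSpace F V)]
  [∀ x, TopologicalSpace (V x)] [FiberBundle F V]
  [∀ x, AddCommGroup (V x)] [∀ x, Module ℝ (V x)] [VectorBundle ℝ F V]

/-- Smooth sections form a module over the smooth functions. -/
instance ContMDiffSection.instModuleSmoothFn :
    Module (SmoothFn E M) Cₛ^∞⟮𝓘(ℝ, E); F, V⟯ where
  smul f s := ⟨fun x => f x • s x, f.contMDiff.smul_section s.contMDiff⟩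
  one_smul s := by ext x; exact one_smul ℝ (s x)
  mul_smul f g s := by ext x; exact mul_smul (f x) (g x) (s x)
  smul_zero f := by ext x; exact smul_zero (f x)
  smul_add f s t := by ext x; exact smul_add (f x) (s x) (t x)
  add_smul f g s := by ext x; exact add_smul (f x) (g x) (s x)
  zero_smul s := by ext x; exact zero_smul ℝ (s x)

variable (V) in
/-- The fibre at `x` of the Atiyah algebroid of `V`: pairs of a tangent vector `ξ` and the value
at `x` of a first-order differential operator on sections of `V` with symbol `Id ⊗ ξ`. -/
def atiyahFibre (x : M) :
    Submodule ℝ (TangentSpace 𝓘(ℝ, E) x × (Cₛ^∞⟮𝓘(ℝ, E); F, V⟯ →ₗ[ℝ] V x)) where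
  carrier := {p | ∀ (f : SmoothFn E M) (a : Cₛ^∞⟮𝓘(ℝ, E); F, V⟯),
    p.2 (f • a) = f x • p.2 a + diffAt E f x p.1 • a x}
  zero_mem' f a := by
    change (0 : V x) = f x • (0 : V x) + diffAt E f x 0 • a x
    rw [map_zero, smul_zero, zero_smul, add_zero]
  add_mem' {p q} hp hq f a := by
    change p.2 (f • a) + q.2 (f • a) =
      f x • (p.2 a + q.2 a) + diffAt E f x (p.1 + q.1) • a x
    rw [hp, hq, map_add, smul_add, add_smul]
    abel
  smul_mem' c p hp f a := by
    change c • p.2 (f • a) = f x • c • p.2 a + diffAt E f x (c • p.1) • a x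
    rw [hp, map_smul, smul_add, smul_comm c, smul_assoc]

section Algebra
variable [∀ x, IsTopologicalAddGroup (V x)] [∀ x, ContinuousSMul ℝ (V x)]

variable (E F V) in
/-- A structure of bundle of associative unital algebras on the vector bundle `V`: the product is
fibrewise bilinear and smooth, the unit is a smooth section. -/
structure AlgebraBundle where
  mul : Cₛ^∞⟮𝓘(ℝ, E); F →L[ℝ] F →L[ℝ] F, fun x : M => V x →L[ℝ] V x →L[ℝ] V x⟯
  one : Cₛ^∞⟮𝓘(ℝ, E); F, V⟯
  mul_assoc : ∀ (x : M) (u v w : V x), mul x (mul x u v) w = mul x u (mul x v w)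
  one_mul : ∀ (x : M) (v : V x), mul x (one x) v = v
  mul_one : ∀ (x : M) (v : V x), mul x v (one x) = v

/-- The algebra of smooth sections of a bundle of algebras, with the pointwise product. -/
def AlgebraBundle.sections (B : AlgebraBundle E F V) :
    AlgebraStructure (SmoothFn E M) Cₛ^∞⟮𝓘(ℝ, E); F, V⟯ where
  mul := LinearMap.mk₂ (SmoothFn E M)
    (fun a b => ⟨fun x => B.mul x (a x) (b x),
      B.mul.contMDiff.clm_bundle_apply₂ a.contMDiff b.contMDiff⟩)
    (fun a a' b => by ext x; exact DFunLike.congr_fun ((B.mul x).map_add (a x) (a' x)) (b x))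
    (fun f a b => by ext x; exact DFunLike.congr_fun ((B.mul x).map_smul (f x) (a x)) (b x))
    (fun a b b' => by ext x; exact (B.mul x (a x)).map_add (b x) (b' x))
    (fun f a b => by ext x; exact (B.mul x (a x)).map_smul (f x) (b x))
  one := B.one
  mul_assoc a b c := by ext x; exact B.mul_assoc x (a x) (b x) (c x)
  one_mul a := by ext x; exact B.one_mul x (a x)
  mul_one a := by ext x; exact B.mul_one x (a x)

end Algebra

/-- The bracket `br` is local: it does not increase supports in either argument. -/
def IsLocalBracket
    (br : SmoothFn E M →ₗ[ℝ] Cₛ^∞⟮𝓘(ℝ, E); F, V⟯ →ₗ[ℝ] Cₛ^∞⟮𝓘(ℝ, E); F, V⟯) : Prop :=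
  ∀ U : Set M, IsOpen U → ∀ (f : SmoothFn E M) (a : Cₛ^∞⟮𝓘(ℝ, E); F, V⟯),
    ((∀ x ∈ U, f x = 0) ∨ (∀ x ∈ U, a x = 0)) → ∀ x ∈ U, br f a x = 0

variable [FiniteDimensional ℝ E] [T2Space M]

variable (F V) in
/-- A `T*M`-connection on `V`, for the cotangent Lie algebroid of the Poisson bracket `P`: a smooth
bundle map `∇ : T*M → 𝒜(V)` over the identity into the Atiyah algebroid, preserving anchors.
Smoothness is expressed on smooth 1-forms and smooth sections. -/
@[ext]
structure CotangentConnection (P : PoissonBracket ℝ (SmoothFn E M)) where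
  toFun : ∀ x : M, CotangentSpace E x →ₗ[ℝ] atiyahFibre (E := E) (F := F) V x
  anchor_eq : ∀ (x : M) (α : CotangentSpace E x), (toFun x α).1.1 = P.anchor x α
  smooth : ∀ (η : OneForm E M) (a : Cₛ^∞⟮𝓘(ℝ, E); F, V⟯),
    ContMDiff 𝓘(ℝ, E) (𝓘(ℝ, E).prod 𝓘(ℝ, F)) ∞
      (fun x => Bundle.TotalSpace.mk' F x ((toFun x (η x)).1.2 a))

namespace CotangentConnection
variable {P : PoissonBracket ℝ (SmoothFn E M)} (C : CotangentConnection F V P)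

/-- The section `∇_η a`. -/
def nabla (η : OneForm E M) (a : Cₛ^∞⟮𝓘(ℝ, E); F, V⟯) : Cₛ^∞⟮𝓘(ℝ, E); F, V⟯ :=
  ⟨fun x => (C.toFun x (η x)).1.2 a, C.smooth η a⟩

/-- `∇_η (ab) = (∇_η a) b + a (∇_η b)` for the algebra structure `m` on sections. -/
def IsDerivation (m : AlgebraStructure (SmoothFn E M) Cₛ^∞⟮𝓘(ℝ, E); F, V⟯) : Prop :=
  ∀ (η : OneForm E M) (a b : Cₛ^∞⟮𝓘(ℝ, E); F, V⟯),
    C.nabla η (m.mul a b) = m.mul (C.nabla η a) b + m.mul a (C.nabla η b)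

/-- The bracket `{f, a} = ∇_{df} a`. -/
def bracket :
    SmoothFn E M →ₗ[ℝ] Cₛ^∞⟮𝓘(ℝ, E); F, V⟯ →ₗ[ℝ] Cₛ^∞⟮𝓘(ℝ, E); F, V⟯ :=
  LinearMap.mk₂ ℝ (fun f a => C.nabla (differential f) a)
    (fun f g a => by
      ext x
      change (C.toFun x (diffAt E (f + g : SmoothFn E M) x)).1.2 a = _
      rw [diffAt_add, map_add]
      rfl)
    (fun c f a => by
      ext x
      change (C.toFun x (diffAt E (c • f : SmoothFn E M) x)).1.2 a = _
      rw [diffAt_smul, map_smul]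
      rfl)
    (fun f a b => by ext x; exact map_add (C.toFun x (diffAt E f x)).1.2 a b)
    (fun c f a => by ext x; exact map_smul (C.toFun x (diffAt E f x)).1.2 c a)

/-- The curvature `Φ_∇(η, φ) = ∇_{[η, φ]} - [∇_η, ∇_φ]`, applied to the section `a`, at `x`. -/
def curvature (η φ : OneForm E M) (a : Cₛ^∞⟮𝓘(ℝ, E); F, V⟯) (x : M) : V x :=
  (C.toFun x (P.formBracket η φ x)).1.2 a
    - (C.nabla η (C.nabla φ a) x - C.nabla φ (C.nabla η a) x)

end CotangentConnection

end Bundle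

end

/-! Everything reduces to exact 1-forms, since each covector at a point is the differential of a
global function (`exists_diffAt_section`). For a fixed section `a`, the map `f ↦ {f, a}(x)` is a
derivation of `C^∞(M)` at `x` with values in `V x`. By Hadamard's lemma it depends only on `df_x`
(`pointDerivation_congr`), and this defines `∇` point by point; its uniqueness is again the fact
that differentials exhaust the covectors. Writing `ga = (g1)a` gives `{f, ga} = g{f, a} + {f, g}a`,
so `{f, ·}` has the Hamiltonian vector field of `f` as symbol and anchors are preserved.

Two properties must then pass from exact forms to all 1-forms. Smoothness does, because near a point
every 1-form is a combination of differentials of global functions with smooth coefficients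
(`OneForm.exists_eventually_eq_sum`). The product rule does, because `η` may be replaced by some
`df` with the same value at the point, and a product that is only assumed `C^∞(M)`-bilinear on
sections is nevertheless fibrewise, by local frames (`sectionMap_apply_congr`).

In the other direction, a connection by derivations kills the unit, and the anchored Leibniz rule
yields `{f, g1} = {f, g}1`. The curvatures agree as soon as `[df, dg] = d{f, g}`, which comes down
to `d² = 0`. -/

open Bundle Filter

/-! ### Differentials, exact 1-forms and local coframes -/

section Forms
variable {E : Type*} [NormedAddCommGroup E] [NormedSpace ℝ E]
  {M : Type*} [TopologicalSpace M] [ChartedSpace E M]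

theorem diffAt_mul (f g : SmoothFn E M) (x : M) :
    diffAt E (f * g : SmoothFn E M) x = f x • diffAt E g x + g x • diffAt E f x := by
  have h := mvfderiv_smul (I := 𝓘(ℝ, E)) (a := f) (g := g) (x := x)
    f.mdifferentiableAt g.mdifferentiableAt
  refine Eq.trans h ?_
  ext v
  simp [diffAt, mul_comm]

variable [IsManifold 𝓘(ℝ, E) ∞ M]

/-- The exterior derivative of the differential of a smooth function vanishes. -/
theorem contractExtDeriv_diffAt (g : SmoothFn E M) (x : M) (u : TangentSpace 𝓘(ℝ, E) x) :
    contractExtDeriv (fun y => diffAt E g y) x u = 0 := by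
  set φ := extChartAt 𝓘(ℝ, E) x with hφ
  have htar : IsOpen φ.target := isOpen_extChartAt_target x
  have hx : φ x ∈ φ.target := φ.map_source (mem_extChartAt_source x)
  have hsymm : ∀ y ∈ φ.target, ContMDiffAt 𝓘(ℝ, E) 𝓘(ℝ, E) ∞ φ.symm y := fun y hy =>
    (contMDiffOn_extChartAt_symm (n := ∞) x).contMDiffAt (htar.mem_nhds hy)
  -- In the chart `dg` is the Fréchet derivative of `g ∘ φ.symm`, so the exterior derivative is the
  -- antisymmetrised second derivative.
  have h1 : oneFormInChart (fun y => diffAt E g y) x =ᶠ[𝓝 (φ x)] fderiv ℝ (g ∘ φ.symm) := by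
    filter_upwards [htar.mem_nhds hx] with y hy
    have := mfderiv_comp y (g.mdifferentiableAt (x := φ.symm y) :
      MDifferentiableAt 𝓘(ℝ, E) 𝓘(ℝ, ℝ) g (φ.symm y))
      ((hsymm y hy).mdifferentiableAt (by simp))
    rw [← mfderiv_eq_fderiv, this]
    rfl
  have h2 : ContDiffAt ℝ ∞ (g ∘ φ.symm) (φ x) := by
    rw [← contMDiffAt_iff_contDiffAt]
    exact g.contMDiff.contMDiffAt.comp _ (hsymm _ hx)
  have h3 : IsSymmSndFDerivAt ℝ (g ∘ φ.symm) (φ x) := h2.isSymmSndFDerivAt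
    (by rw [minSmoothness_of_isRCLikeNormedField]; exact WithTop.coe_le_coe.2 le_top)
  unfold contractExtDeriv
  rw [h1.fderiv_eq]
  ext v
  exact sub_eq_zero.2 (h3 _ _)

variable [FiniteDimensional ℝ E] [T2Space M]

theorem PoissonBracket.bracket_swap {κ Z : Type*} [Field κ] [CommRing Z] [Algebra κ Z]
    (P : PoissonBracket κ Z) (f g : Z) : P.bracket g f = - P.bracket f g := by
  have := P.bracket_self (f + g)
  simp only [map_add, LinearMap.add_apply, P.bracket_self, zero_add, add_zero] at this
  exact eq_neg_of_add_eq_zero_left this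

/-- The bracket of exact 1-forms: `[df, dg] = d{f, g}`. -/
theorem PoissonBracket.formBracket_differential (P : PoissonBracket ℝ (SmoothFn E M))
    (f g : SmoothFn E M) (x : M) :
    P.formBracket (differential f) (differential g) x = diffAt E (P.bracket f g) x := by
  have h : ∀ f g : SmoothFn E M,
      (fun y => (differential g y : CotangentSpace E y) (P.anchor y (differential f y)))
        = P.bracket f g := fun f g => funext fun y => P.anchor_spec y f g
  have hl : ∀ f g : SmoothFn E M,
      lieDerivOneForm (fun y => P.anchor y (differential f y)) (differential g) x
        = diffAt E (P.bracket f g) x := fun f g => by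
    unfold lieDerivOneForm
    rw [h f g]
    exact (congrArg (· + _) (contractExtDeriv_diffAt g x _)).trans (zero_add _)
  have hneg : diffAt E (P.bracket g f) x = - diffAt E (P.bracket f g) x := by
    rw [P.bracket_swap f g, ← neg_one_smul ℝ (P.bracket f g), diffAt_smul]
    exact neg_one_smul ℝ (diffAt E (P.bracket f g) x)
  unfold PoissonBracket.formBracket
  -- The three terms are `d{f, g}`, `-d{g, f} = d{f, g}` and `-d{f, g}`.
  rw [hl, hl, h f g, hneg]
  abel

/-- A point derivation of `C^∞(M)` with values in a vector space depends only on differentials. -/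
theorem pointDerivation_congr {W : Type*} [AddCommGroup W] [Module ℝ W] {x : M}
    (D : SmoothFn E M →ₗ[ℝ] W) (hD : ∀ f g, D (f * g) = f x • D g + g x • D f)
    {f g : SmoothFn E M} (h : diffAt E f x = diffAt E g x) : D f = D g := by
  have h1 : D 1 = 0 := by
    have := hD 1 1
    rw [mul_one] at this
    change D 1 = (1 : ℝ) • D 1 + (1 : ℝ) • D 1 at this
    simpa using this
  have hd : diffAt E (1 : SmoothFn E M) x = 0 := mvfderiv_const (1 : ℝ)
  -- The constant, which `D` kills, is subtracted so that the function as well as its differential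
  -- vanishes at `x`.
  suffices hs : D (f - g - (f x - g x) • 1) = 0 by
    rw [map_sub, map_sub, map_smul, h1, smul_zero, sub_zero] at hs
    exact sub_eq_zero.1 hs
  -- Linear functionals separate the points of `W`, which leaves real-valued derivations.
  rw [← Module.forall_dual_apply_eq_zero_iff ℝ]
  intro ℓ
  refine pointDerivation_eq_zero (x := x) (ℓ ∘ₗ D) (fun a b => ?_) _ ?_ ?_
  · simp [hD]
  · change f x - g x - (f x - g x) * 1 = 0
    ring
  · rw [diffAt_sub, diffAt_sub, diffAt_smul, hd, h, smul_zero, sub_zero, sub_self]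

/-- A smooth function equal to `1` near `x`, with support in a given neighbourhood of `x`. -/
theorem exists_smoothFn_eventuallyEq_one {x : M} {u : Set M} (hu : u ∈ 𝓝 x) :
    ∃ χ : SmoothFn E M, (∀ᶠ y in 𝓝 x, χ y = 1) ∧ tsupport χ ⊆ u := by
  obtain ⟨χ, -, hχ⟩ := (SmoothBumpFunction.nhds_basis_tsupport (I := 𝓘(ℝ, E)) x).mem_iff.1 hu
  exact ⟨⟨χ, χ.contMDiff⟩, χ.eventuallyEq_one, hχ⟩

/-- Near any point, a 1-form is a combination of differentials of globally defined functions. -/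
theorem OneForm.exists_eventually_eq_sum (η : OneForm E M) (x₀ : M) :
    ∃ (p : Fin (Module.finrank ℝ E) → SmoothFn E M) (c : Fin (Module.finrank ℝ E) → M → ℝ),
      (∀ i, ContMDiffAt 𝓘(ℝ, E) 𝓘(ℝ, ℝ) ∞ (c i) x₀) ∧
      ∀ᶠ x in 𝓝 x₀, (η x : CotangentSpace E x) = ∑ i, c i x • diffAt E (p i) x := by
  let φ := extChartAt 𝓘(ℝ, E) x₀
  let e := trivializationAt E (TangentSpace 𝓘(ℝ, E) : M → Type _) x₀
  have he₀ : x₀ ∈ e.baseSet := FiberBundle.mem_baseSet_trivializationAt E _ x₀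
  let b := Module.finBasis ℝ E
  obtain ⟨χ, hχ, hχs⟩ := exists_smoothFn_eventuallyEq_one (E := E)
    ((chartAt E x₀).open_source.mem_nhds (mem_chart_source E x₀))
  have hφs : ContMDiffOn 𝓘(ℝ, E) 𝓘(ℝ, E) ∞ φ (chartAt E x₀).source := contMDiffOn_extChartAt
  -- Chart coordinates, cut off so as to be globally defined.
  let p : Fin (Module.finrank ℝ E) → SmoothFn E M := fun i =>
    ⟨fun z => χ z • (b.coord i).toContinuousLinearMap (φ z), contMDiff_of_tsupport fun z hz => by
      have hz' : z ∈ (chartAt E x₀).source := hχs (closure_mono (fun y hy => by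
        contrapose! hy
        simp [Function.notMem_support.1 hy]) hz)
      exact χ.contMDiff.contMDiffAt.smul
        ((b.coord i).toContinuousLinearMap.contDiff.contMDiff.contMDiffAt.comp z
          (hφs.contMDiffAt ((chartAt E x₀).open_source.mem_nhds hz')))⟩
  -- The coefficients are the values of `η` on the coordinate vector fields, the frame dual to the
  -- differentials of the coordinates.
  refine ⟨p, fun i x => (η x : CotangentSpace E x) (e.localFrame b i x), fun i => ?_, ?_⟩
  · have h1 := contMDiffAt_localFrame_of_mem (I := 𝓘(ℝ, E)) ∞ e b i he₀
    have h2 := (η.contMDiff x₀).clm_bundle_apply h1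
    exact (contMDiffAt_section x₀).1 h2
  -- Differentials at points `x` other than `x₀` are needed, hence `χ = 1` on a neighbourhood of
  -- each nearby `x`.
  · filter_upwards [hχ.eventually_nhds, e.open_baseSet.mem_nhds he₀] with x hx hxe
    have hxs : x ∈ (chartAt E x₀).source := by simpa [e] using hxe
    have hp : ∀ i v, diffAt E (p i) x v = b.coord i ((e ⟨x, v⟩).2) := by
      intro i v
      have h2 : HasMFDerivAt 𝓘(ℝ, E) 𝓘(ℝ, E) φ x (mfderiv 𝓘(ℝ, E) 𝓘(ℝ, E) φ x) :=
        (mdifferentiableAt_extChartAt hxs).hasMFDerivAt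
      have h3 := ((b.coord i).toContinuousLinearMap.hasFDerivAt (x := φ x)).hasMFDerivAt.comp x h2
      have h4 : (p i : M → ℝ) =ᶠ[𝓝 x] (b.coord i).toContinuousLinearMap ∘ φ := by
        filter_upwards [hx] with z hz
        change χ z • (b.coord i).toContinuousLinearMap (φ z) = _
        rw [hz, one_smul]
        rfl
      have h5 : diffAt E (p i) x
          = (b.coord i).toContinuousLinearMap.comp (mfderiv 𝓘(ℝ, E) 𝓘(ℝ, E) φ x) := by
        unfold diffAt mvfderiv
        rw [(h3.congr_of_eventuallyEq h4).mfderiv]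
        rfl
      -- The tangent trivialization is the derivative of the chart, so `d(p i)` reads off the `i`-th
      -- coordinate.
      rw [h5, ← TangentBundle.continuousLinearMapAt_trivializationAt hxs]
      change b.coord i (e.linearMapAt ℝ x v) = _
      rw [e.linearMapAt_apply, if_pos hxe]
    ext v
    have hv : v = ∑ i, b.coord i ((e ⟨x, v⟩).2) • e.localFrame b i x := by
      conv_lhs => rw [← (e.basisAt b hxe).sum_repr v]
      refine Finset.sum_congr rfl fun i _ => ?_
      rw [e.localFrame_apply_of_mem_baseSet b hxe]
      simp [Trivialization.basisAt]
    conv_lhs => rw [hv]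
    simp [hp, mul_comm]

end Forms

/-! ### Global sections, local frames and tensoriality -/

section Sections
variable {E : Type*} [NormedAddCommGroup E] [NormedSpace ℝ E] [FiniteDimensional ℝ E]
  {M : Type*} [TopologicalSpace M] [ChartedSpace E M] [IsManifold 𝓘(ℝ, E) ∞ M] [T2Space M]
  {F : Type*} [NormedAddCommGroup F] [NormedSpace ℝ F]
  {V : M → Type*} [TopologicalSpace (TotalSpace F V)]
  [∀ x, TopologicalSpace (V x)] [∀ x, AddCommGroup (V x)] [∀ x, Module ℝ (V x)]
  [FiberBundle F V] [VectorBundle ℝ F V]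

/-- Evaluation of smooth sections at a point. -/
noncomputable def sectionEval (x : M) : Cₛ^∞⟮𝓘(ℝ, E); F, V⟯ →ₗ[ℝ] V x where
  toFun a := a x
  map_add' _ _ := rfl
  map_smul' _ _ := rfl

omit [FiniteDimensional ℝ E] [IsManifold 𝓘(ℝ, E) ∞ M] [T2Space M] in
theorem sum_smul_section_apply {ι : Type*} (s : Finset ι) (c : ι → SmoothFn E M)
    (a : ι → Cₛ^∞⟮𝓘(ℝ, E); F, V⟯) (x : M) : (∑ i ∈ s, c i • a i) x = ∑ i ∈ s, c i x • a i x :=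
  map_sum (sectionEval x) (fun i => c i • a i) s

variable [FiniteDimensional ℝ F] [ContMDiffVectorBundle ∞ F V 𝓘(ℝ, E)]

/-- Global sections which form a frame near `x`: up to a factor equal to `1` at `x`, every section
is a combination of them, and their values span the fibre at `x`. -/
theorem exists_section_frame (x : M) :
    ∃ (χ : SmoothFn E M) (s : Fin (Module.finrank ℝ F) → Cₛ^∞⟮𝓘(ℝ, E); F, V⟯), χ x = 1 ∧
      (∀ a : Cₛ^∞⟮𝓘(ℝ, E); F, V⟯, ∃ c : Fin (Module.finrank ℝ F) → SmoothFn E M,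
        χ • a = ∑ i, c i • s i ∧ (a x = 0 → ∀ i, c i x = 0)) ∧
      ∀ v : V x, ∃ k : Fin (Module.finrank ℝ F) → ℝ, v = ∑ i, k i • s i x := by
  let e := trivializationAt F V x
  have he : x ∈ e.baseSet := FiberBundle.mem_baseSet_trivializationAt F V x
  let b := Module.finBasis ℝ F
  have : ContMDiffVectorBundle 1 F V 𝓘(ℝ, E) := ContMDiffVectorBundle.of_le (n := ∞) (by simp)
  obtain ⟨χ, hχ, hχs⟩ := exists_smoothFn_eventuallyEq_one (E := E) (e.open_baseSet.mem_nhds he)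
  have hx : χ x = 1 := hχ.self_of_nhds
  let s : Fin (Module.finrank ℝ F) → Cₛ^∞⟮𝓘(ℝ, E); F, V⟯ := fun i =>
    ⟨fun y => χ y • e.localFrame b i y,
      (χ.contMDiff.contMDiffOn).smul_section_of_tsupport e.open_baseSet hχs
        (e.contMDiffOn_localFrame_baseSet (I := 𝓘(ℝ, E)) ∞ b i)⟩
  let c (a : Cₛ^∞⟮𝓘(ℝ, E); F, V⟯) (i : Fin (Module.finrank ℝ F)) : SmoothFn E M :=
    ⟨fun y => χ y • e.localFrameCoeff 𝓘(ℝ, E) b i y (a y), contMDiff_of_tsupport fun y hy => by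
      have hy' : y ∈ e.baseSet := hχs (closure_mono (fun z hz => by
        contrapose! hz
        simp [Function.notMem_support.1 hz]) hy)
      exact χ.contMDiff.contMDiffAt.smul (contMDiffAt_localFrameCoeff b hy' (a.contMDiff y) i)⟩
  -- The square appears because the frame sections and the coefficients each carry one factor `χ` to
  -- become global.
  refine ⟨χ * χ, s, ?_, fun a => ⟨c a, ?_, fun ha i => ?_⟩, fun v => ?_⟩
  · change χ x * χ x = 1
    rw [hx, one_mul]
  · ext y
    rw [sum_smul_section_apply]
    change (χ y * χ y) • a y
      = ∑ i, (χ y • e.localFrameCoeff 𝓘(ℝ, E) b i y (a y)) • (χ y • e.localFrame b i y)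
    by_cases hy : y ∈ e.baseSet
    · conv_lhs => rw [e.eq_sum_localFrameCoeff_smul (I := 𝓘(ℝ, E)) (b := b) (s := a) hy]
      rw [Finset.smul_sum]
      refine Finset.sum_congr rfl fun i _ => ?_
      simp only [smul_smul, smul_eq_mul]
      congr 1
      ring
    · have : χ y = 0 := image_eq_zero_of_notMem_tsupport fun h => hy (hχs h)
      simp [this]
  · change χ x • e.localFrameCoeff 𝓘(ℝ, E) b i x (a x) = 0
    rw [ha, map_zero, smul_zero]
  · refine ⟨fun i => (e.basisAt b he).repr v i, ?_⟩
    conv_lhs => rw [← (e.basisAt b he).sum_repr v]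
    refine Finset.sum_congr rfl fun i _ => ?_
    change _ = _ • χ x • e.localFrame b i x
    rw [hx, one_smul, e.localFrame_apply_of_mem_baseSet b he]

/-- A `C^∞(M)`-linear map between sections acts pointwise. -/
theorem sectionMap_apply_congr
    (T : Cₛ^∞⟮𝓘(ℝ, E); F, V⟯ →ₗ[SmoothFn E M] Cₛ^∞⟮𝓘(ℝ, E); F, V⟯)
    {a a' : Cₛ^∞⟮𝓘(ℝ, E); F, V⟯} {x : M} (h : a x = a' x) : T a x = T a' x := by
  obtain ⟨χ, s, hχ, hs, -⟩ := exists_section_frame (E := E) (F := F) (V := V) x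
  obtain ⟨c, hc, hc0⟩ := hs (a - a')
  have h0 : (a - a') x = 0 := sub_eq_zero.2 h
  -- After multiplication by a function equal to `1` at `x`, the difference is a combination of
  -- sections with coefficients vanishing at `x`; linearity of `T` carries them outside.
  have h1 := congrArg (fun a => T a x) hc
  simp only [map_smul, map_sum] at h1
  rw [sum_smul_section_apply, Finset.sum_eq_zero fun i _ => by rw [hc0 h0 i, zero_smul]] at h1
  change χ x • T (a - a') x = 0 at h1
  rw [hχ, one_smul, map_sub] at h1
  exact sub_eq_zero.1 h1

theorem exists_section_apply_eq {x : M} (v : V x) : ∃ a : Cₛ^∞⟮𝓘(ℝ, E); F, V⟯, a x = v := by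
  obtain ⟨χ, s, -, -, hs⟩ := exists_section_frame (E := E) (F := F) (V := V) x
  obtain ⟨k, rfl⟩ := hs v
  exact ⟨∑ i, k i • s i, by
    change sectionEval x (∑ i, k i • s i) = _
    simp [sectionEval]⟩

omit [FiniteDimensional ℝ F] [ContMDiffVectorBundle ∞ F V 𝓘(ℝ, E)] in
/-- A family of linear maps on cotangent spaces is smooth if it is so on exact 1-forms. -/
theorem contMDiff_apply_oneForm (L : ∀ x : M, CotangentSpace E x →ₗ[ℝ] V x)
    (hL : ∀ f : SmoothFn E M, ContMDiff 𝓘(ℝ, E) (𝓘(ℝ, E).prod 𝓘(ℝ, F)) ∞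
      (fun x => TotalSpace.mk' F x (L x (diffAt E f x)))) (η : OneForm E M) :
    ContMDiff 𝓘(ℝ, E) (𝓘(ℝ, E).prod 𝓘(ℝ, F)) ∞ (fun x => TotalSpace.mk' F x (L x (η x))) := by
  intro x₀
  obtain ⟨p, c, hc, hη⟩ := η.exists_eventually_eq_sum x₀
  have h : ContMDiffAt 𝓘(ℝ, E) (𝓘(ℝ, E).prod 𝓘(ℝ, F)) ∞
      (fun x => TotalSpace.mk' F x (∑ i, c i x • L x (diffAt E (p i) x))) x₀ :=
    ContMDiffAt.sum_section fun i _ => (hc i).smul_section (hL (p i) x₀)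
  refine h.congr_of_eventuallyEq ?_
  -- Each `L x` is linear, so the coefficients come out as numbers and need not extend to global
  -- functions.
  filter_upwards [hη] with x hx
  rw [hx, map_sum]
  simp

end Sections

/-! ### From connections to Poisson fibred algebras -/

section Main
variable {E : Type*} [NormedAddCommGroup E] [NormedSpace ℝ E] [FiniteDimensional ℝ E]
  {M : Type*} [TopologicalSpace M] [ChartedSpace E M] [IsManifold 𝓘(ℝ, E) ∞ M] [T2Space M]
  {F : Type*} [NormedAddCommGroup F] [NormedSpace ℝ F]
  {V : M → Type*} [TopologicalSpace (TotalSpace F V)]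
  [∀ x, TopologicalSpace (V x)] [∀ x, AddCommGroup (V x)] [∀ x, Module ℝ (V x)]
  [FiberBundle F V] [VectorBundle ℝ F V]

theorem CotangentConnection.toFun_smul {P : PoissonBracket ℝ (SmoothFn E M)}
    (C : CotangentConnection F V P) (x : M) (α : CotangentSpace E x) (f : SmoothFn E M)
    (a : Cₛ^∞⟮𝓘(ℝ, E); F, V⟯) :
    (C.toFun x α).1.2 (f • a) = f x • (C.toFun x α).1.2 a + diffAt E f x (P.anchor x α) • a x := by
  rw [← C.anchor_eq]
  exact (C.toFun x α).2 f a

/-- The curvature of the bracket `{f, a} = ∇_{df} a` is that of the connection. -/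
theorem CotangentConnection.poissonFibredCurvature_bracket {P : PoissonBracket ℝ (SmoothFn E M)}
    (C : CotangentConnection F V P) (f g : SmoothFn E M) (a : Cₛ^∞⟮𝓘(ℝ, E); F, V⟯) (x : M) :
    poissonFibredCurvature P C.bracket f g a x
      = C.curvature (differential f) (differential g) a x := by
  unfold CotangentConnection.curvature
  rw [P.formBracket_differential]
  change (C.toFun x (diffAt E (P.bracket f g) x)).1.2 a
      - C.nabla (differential f) (C.nabla (differential g) a) x
      + C.nabla (differential g) (C.nabla (differential f) a) x = _
  abel

-- A zero unit would force `v = 1v = 0` for every `v`, whereas the fibre is isomorphic to the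
-- nonzero space `F`.
omit [FiniteDimensional ℝ E] [IsManifold 𝓘(ℝ, E) ∞ M] [T2Space M] in
theorem AlgebraBundle.one_ne_zero [Nontrivial F]
    [∀ x, IsTopologicalAddGroup (V x)] [∀ x, ContinuousSMul ℝ (V x)] (B : AlgebraBundle E F V)
    (x : M) : B.one x ≠ 0 := fun h => by
  have : Nontrivial (V x) := ((trivializationAt F V x).linearEquivAt (R := ℝ) x
    (FiberBundle.mem_baseSet_trivializationAt F V x)).toEquiv.nontrivial
  obtain ⟨v, hv⟩ := exists_ne (0 : V x)
  exact hv (by rw [← B.one_mul x v, h, map_zero]; rfl)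

theorem CotangentConnection.isPoissonFibredAlgebra [Nontrivial F]
    [∀ x, IsTopologicalAddGroup (V x)] [∀ x, ContinuousSMul ℝ (V x)]
    {P : PoissonBracket ℝ (SmoothFn E M)} (B : AlgebraBundle E F V) (C : CotangentConnection F V P)
    (hC : C.IsDerivation B.sections) : IsPoissonFibredAlgebra P B.sections C.bracket where
  injective f g h := by
    ext x
    have h1 : f x • B.one x = g x • B.one x := DFunLike.congr_fun h x
    exact smul_left_injective ℝ (B.one_ne_zero x) h1
  restrict f g := by
    -- From `1·1 = 1` the product rule gives `∇1 = ∇1 + ∇1`.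
    have h0 : C.nabla (differential f) B.one = 0 := by
      have h1 : B.sections.mul B.one B.one = B.one := B.sections.one_mul B.one
      have h2 := hC (differential f) B.one B.one
      have h3 : B.sections.mul (C.nabla (differential f) B.one) B.one
          = C.nabla (differential f) B.one := B.sections.mul_one _
      have h4 : B.sections.mul B.one (C.nabla (differential f) B.one)
          = C.nabla (differential f) B.one := B.sections.one_mul _
      rw [h1, h3, h4] at h2
      exact left_eq_add.1 h2
    ext x
    -- As `∇1 = 0`, only the symbol term `(ρ(df)g)1 = {f, g}1` survives.
    refine (C.toFun_smul x (diffAt E f x) g B.one).trans ?_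
    have h5 : (C.toFun x (diffAt E f x)).1.2 B.one = 0 := DFunLike.congr_fun h0 x
    rw [h5, smul_zero, zero_add, P.anchor_spec]
    rfl
  map_mul f a b := hC (differential f) a b
  mul_map f g a := by
    ext x
    change (C.toFun x (diffAt E (f * g : SmoothFn E M) x)).1.2 a
      = f x • (C.toFun x (diffAt E g x)).1.2 a + g x • (C.toFun x (diffAt E f x)).1.2 a
    rw [diffAt_mul, map_add, map_smul, map_smul]
    rfl

/-- If the centre of every fibre consists of scalars, then the centre of the algebra of sections
consists of the multiples of the unit by smooth functions. -/
theorem AlgebraBundle.exists_eq_smul_one_of_isCentral [FiniteDimensional ℝ F] [Nontrivial F]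
    [ContMDiffVectorBundle ∞ F V 𝓘(ℝ, E)]
    [∀ x, IsTopologicalAddGroup (V x)] [∀ x, ContinuousSMul ℝ (V x)] (B : AlgebraBundle E F V)
    (hB : ∀ (x : M) (v : V x), (∀ w, B.mul x v w = B.mul x w v) → ∃ c : ℝ, v = c • B.one x)
    (a : Cₛ^∞⟮𝓘(ℝ, E); F, V⟯) (ha : B.sections.IsCentral a) :
    ∃ f : SmoothFn E M, a = f • B.sections.one := by
  -- Sections take every value in a fibre, so a central section has central values.
  have h1 : ∀ x, ∃ c : ℝ, a x = c • B.one x := fun x => hB x (a x) fun w => by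
    obtain ⟨b, rfl⟩ := exists_section_apply_eq (E := E) (F := F) w
    exact DFunLike.congr_fun (ha b) x
  choose c hc using h1
  refine ⟨⟨c, fun x => ?_⟩, by ext x; exact hc x⟩
  let e := trivializationAt F V x
  have he : x ∈ e.baseSet := FiberBundle.mem_baseSet_trivializationAt F V x
  have h1 := (contMDiffAt_section x).1 (a.contMDiff x)
  have h2 := (contMDiffAt_section x).1 (B.one.contMDiff x)
  have h3 : (e ⟨x, B.one x⟩).2 ≠ 0 := fun h0 => by
    let ε := e.linearEquivAt (R := ℝ) x he
    exact B.one_ne_zero x (ε.injective (h0.trans (map_zero ε).symm))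
  -- A functional nonzero on the unit at `x` exhibits `c` near `x` as the quotient `ℓ(a) / ℓ(1)` of
  -- smooth functions.
  obtain ⟨ℓ, hℓ⟩ := SeparatingDual.exists_ne_zero (R := ℝ) h3
  have h4 := (ℓ.contMDiff (n := ∞)).contMDiffAt.comp x h1
  have h5 := (ℓ.contMDiff (n := ∞)).contMDiffAt.comp x h2
  refine (h4.div₀ h5 hℓ).congr_of_eventuallyEq ?_
  filter_upwards [h5.continuousAt.eventually_ne hℓ, e.open_baseSet.mem_nhds he] with y hy hye
  have h6 : (e ⟨y, a y⟩).2 = c y • (e ⟨y, B.one y⟩).2 := by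
    rw [hc y]
    exact map_smul (e.linearEquivAt (R := ℝ) y hye) (c y) (B.one y)
  change c y = ℓ (e ⟨y, a y⟩).2 / ℓ (e ⟨y, B.one y⟩).2
  rw [h6, map_smul, smul_eq_mul]
  exact (mul_div_cancel_right₀ _ hy).symm

/-! ### From Poisson fibred algebras to connections -/

/-- Apply the product rule to `ga = (g1)a`. This is what places `{f, ·}` in the Atiyah algebroid,
over the Hamiltonian vector field of `f`. -/
theorem IsPoissonFibredAlgebra.map_smul {κ Z A : Type*} [Field κ] [CommRing Z] [Algebra κ Z]
    [AddCommGroup A] [Module κ A] [Module Z A] {P : PoissonBracket κ Z} {m : AlgebraStructure Z A}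
    {br : Z →ₗ[κ] A →ₗ[κ] A} (h : IsPoissonFibredAlgebra P m br) (f g : Z) (a : A) :
    br f (g • a) = g • br f a + P.bracket f g • a := by
  have hm : ∀ (g : Z) (a : A), m.mul (g • m.one) a = g • a := fun g a => by
    rw [_root_.map_smul, LinearMap.smul_apply, m.one_mul]
  rw [← hm g a, h.map_mul, h.restrict, hm, hm, add_comm]

/-- The bracket of a Poisson fibred algebra of sections is a bundle map applied to differentials. -/
theorem IsPoissonFibredAlgebra.exists_connection {P : PoissonBracket ℝ (SmoothFn E M)}
    {m : AlgebraStructure (SmoothFn E M) Cₛ^∞⟮𝓘(ℝ, E); F, V⟯}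
    {br : SmoothFn E M →ₗ[ℝ] Cₛ^∞⟮𝓘(ℝ, E); F, V⟯ →ₗ[ℝ] Cₛ^∞⟮𝓘(ℝ, E); F, V⟯}
    (h : IsPoissonFibredAlgebra P m br) :
    ∃ C : CotangentConnection F V P, C.bracket = br := by
  choose s hs using exists_diffAt_section (E := E) (M := M)
  have key : ∀ (x : M) (f g : SmoothFn E M) (a : Cₛ^∞⟮𝓘(ℝ, E); F, V⟯),
      diffAt E f x = diffAt E g x → br f a x = br g a x := fun x f g a hfg =>
    pointDerivation_congr (sectionEval x ∘ₗ br.flip a)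
      (fun f g => DFunLike.congr_fun (h.mul_map f g a) x) hfg
  have hbr : ∀ (x : M) (f : SmoothFn E M) (a : Cₛ^∞⟮𝓘(ℝ, E); F, V⟯),
      br (s x (diffAt E f x)) a x = br f a x := fun x f a => key x _ _ a (hs x _)
  -- At `x`, `∇_α a` is `{s x α, a}(x)`, with `s x α` a function whose differential at `x` is `α`;
  -- linearity of `s x` gives linearity in `α`.
  let C : CotangentConnection F V P :=
    { toFun := fun x => LinearMap.codRestrict _
        ((P.anchor x).prod
          ((LinearMap.compRight ℝ (sectionEval x) ∘ₗ br) ∘ₗ s x))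
        (fun α f a => by
          change br (s x α) (f • a) x = f x • br (s x α) a x + diffAt E f x (P.anchor x α) • a x
          rw [h.map_smul]
          change f x • br (s x α) a x + P.bracket (s x α) f x • a x = _
          rw [← P.anchor_spec, hs])
      anchor_eq := fun _ _ => rfl
      smooth := fun η a => contMDiff_apply_oneForm
        (fun x => (sectionEval x ∘ₗ br.flip a) ∘ₗ s x)
        (fun f => (br f a).contMDiff.congr fun x => congrArg _ (hbr x f a)) η }
  exact ⟨C, LinearMap.ext fun f => LinearMap.ext fun a => ContMDiffSection.ext fun x => hbr x f a⟩

/-- The anchor fixes the tangent component, and the operator component is known on differentials,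
which fill each cotangent space. -/
theorem CotangentConnection.bracket_injective {P : PoissonBracket ℝ (SmoothFn E M)} :
    Function.Injective (CotangentConnection.bracket (F := F) (V := V) (P := P)) := by
  intro C C' h
  refine CotangentConnection.ext (funext fun x => LinearMap.ext fun α => Subtype.ext ?_)
  refine Prod.ext ((C.anchor_eq x α).trans (C'.anchor_eq x α).symm) (LinearMap.ext fun a => ?_)
  obtain ⟨s, hs⟩ := exists_diffAt_section (E := E) x
  rw [← hs α]
  exact DFunLike.congr_fun (LinearMap.congr_fun (LinearMap.congr_fun h (s α)) a) x

/-- At a given point `η` agrees with some `df`, but `∇_η a` and `{f, a}` then agree only at that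
point. Comparing their products there requires `m.mul` to act pointwise in each argument. -/
theorem CotangentConnection.isDerivation_of_bracket [FiniteDimensional ℝ F]
    [ContMDiffVectorBundle ∞ F V 𝓘(ℝ, E)] {P : PoissonBracket ℝ (SmoothFn E M)}
    {m : AlgebraStructure (SmoothFn E M) Cₛ^∞⟮𝓘(ℝ, E); F, V⟯} (C : CotangentConnection F V P)
    (h : ∀ f a b, C.bracket f (m.mul a b) = m.mul (C.bracket f a) b + m.mul a (C.bracket f b)) :
    C.IsDerivation m := by
  intro η a b
  ext x
  obtain ⟨s, hs⟩ := exists_diffAt_section (E := E) x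
  have hf : ∀ c, C.nabla η c x = C.bracket (s (η x)) c x := fun c => by
    change _ = (C.toFun x (diffAt E (s (η x)) x)).1.2 c
    rw [hs]
    rfl
  rw [hf, h]
  exact congrArg₂ (· + ·) (sectionMap_apply_congr (m.mul.flip b) (hf a).symm)
    (sectionMap_apply_congr (m.mul a) (hf b).symm)

end Main

theorem mainTheorem3
    {E : Type*} [NormedAddCommGroup E] [NormedSpace ℝ E] [FiniteDimensional ℝ E]
    {M : Type*} [TopologicalSpace M] [ChartedSpace E M] [IsManifold 𝓘(ℝ, E) ∞ M] [T2Space M]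
    {F : Type*} [NormedAddCommGroup F] [NormedSpace ℝ F] [FiniteDimensional ℝ F] [Nontrivial F]
    {V : M → Type*} [TopologicalSpace (Bundle.TotalSpace F V)]
    [∀ x, TopologicalSpace (V x)] [∀ x, AddCommGroup (V x)] [∀ x, Module ℝ (V x)]
    [∀ x, IsTopologicalAddGroup (V x)] [∀ x, ContinuousSMul ℝ (V x)]
    [FiberBundle F V] [VectorBundle ℝ F V] [ContMDiffVectorBundle ∞ F V 𝓘(ℝ, E)] :
    -- a connection by derivations on a bundle of algebras gives a Poisson fibred algebra
    (∀ (P : PoissonBracket ℝ (SmoothFn E M)) (B : AlgebraBundle E F V)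
        (C : CotangentConnection F V P), C.IsDerivation B.sections →
      IsPoissonFibredAlgebra P B.sections C.bracket ∧
      ((∀ (x : M) (v : V x), (∀ w, B.mul x v w = B.mul x w v) → ∃ c : ℝ, v = c • B.one x) →
        ∀ a, B.sections.IsCentral a → ∃ f : SmoothFn E M, a = f • B.sections.one) ∧
      ∀ (f g : SmoothFn E M) (a : Cₛ^∞⟮𝓘(ℝ, E); F, V⟯) (x : M),
        poissonFibredCurvature P C.bracket f g a x
          = C.curvature (differential f) (differential g) a x) ∧
    -- every local Poisson fibred algebra structure arises from a unique such connection
    (∀ (P : PoissonBracket ℝ (SmoothFn E M))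
        (m : AlgebraStructure (SmoothFn E M) Cₛ^∞⟮𝓘(ℝ, E); F, V⟯)
        (br : SmoothFn E M →ₗ[ℝ] Cₛ^∞⟮𝓘(ℝ, E); F, V⟯ →ₗ[ℝ] Cₛ^∞⟮𝓘(ℝ, E); F, V⟯),
        IsPoissonFibredAlgebra P m br → IsLocalBracket br →
      ∃ C : CotangentConnection F V P,
        C.IsDerivation m ∧
        (∀ f a, br f a = C.nabla (differential f) a) ∧
        (∀ (f g : SmoothFn E M) (a : Cₛ^∞⟮𝓘(ℝ, E); F, V⟯) (x : M),
          poissonFibredCurvature P br f g a x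
            = C.curvature (differential f) (differential g) a x) ∧
        ∀ C' : CotangentConnection F V P,
          (∀ f a, br f a = C'.nabla (differential f) a) → C' = C) := by
  refine ⟨fun P B C hC => ⟨C.isPoissonFibredAlgebra B hC, B.exists_eq_smul_one_of_isCentral,
    C.poissonFibredCurvature_bracket⟩, fun P m br h _ => ?_⟩
  -- With `br` replaced by `C.bracket`, the remaining claims concern a connection alone.
  obtain ⟨C, rfl⟩ := h.exists_connection
  refine ⟨C, C.isDerivation_of_bracket h.map_mul, fun _ _ => rfl,
    C.poissonFibredCurvature_bracket, fun C' h' => CotangentConnection.bracket_injective ?_⟩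
  exact LinearMap.ext fun f => LinearMap.ext fun a => (h' f a).symm
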